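/- Let $X$ be a set and let $T_X$ be the absolutely free algebra on $X$ with one binary operation $*$; its elements are called terms, those of $X$ variables. Let $=_{LD}$ (LD-equivalence) be the congruence on $T_X$ generated by all pairs $(T_1*(T_2*T_3),\ (T_1*T_2)*(T_1*T_3))$. View terms as binary trees with leaves labelled by variables; an address is a finite sequence of $0$s (left) and $1$s (right). The Polish expression of a term is the word $\mathrm{pol}(x)=x$ for a variable $x$, and $\mathrm{pol}(T_0*T_1)=\mathrm{pol}(T_0)\,\mathrm{pol}(T_1)\,\bullet$. If $\alpha$ is the address of a leaf of $T$, then $\mathrm{cut}(T,\alpha)$ is the term whose Polish expression is $w\,\bullet^p$, where $w$ is the prefix of $\mathrm{pol}(T)$ that finishes with the variable at $\alpha$ and $p\ge 0$ is the unique number for which $w\,\bullet^p$ is the Polish expression of a term; equivalently, $\mathrm{cut}(x,\emptyset)=x$, $\mathrm{cut}(T_0*T_1,0\alpha)=\mathrm{cut}(T_0,\alpha)$ and $\mathrm{cut}(T_0*T_1,1\alpha)=T_0*\mathrm{cut}(T_1,\alpha)$. Let $\overline T$ be the one-variable term obtained from $T$ by mapping every variable to one variable $x$. Write $S\sqsubset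 T$ if $S$ is a proper iterated left subterm of $T$, that is, for the transitive closure of the relation "$S*R=T$ for some $R$". Applying LD at an address $\alpha$ in the expanding direction means replacing the subterm at $\alpha$, which must be of the form $T_1*(T_2*T_3)$, with $(T_1*T_2)*(T_1*T_3)$; for a finite sequence $s$ of addresses, $\mathrm{Expand}(T,s)$ is the result, when defined, of doing so successively at the addresses in $s$. (1) If $T,T'$ are terms and $\alpha,\alpha'$ are addresses of leaves of $T$ and $T'$ such that $\mathrm{cut}(T,\alpha)$ and $\mathrm{cut}(T',\alpha')$ coincide except in their rightmost variables, which are different, then $T$ and $T'$ are not LD-equivalent. (2) If $T,T'$ are terms with $\overline T=\overline{T'}$, then $T=_{LD}T'$ if and only if $T=T'$. (3) Let $(s_n,s'_n)_{n\ge0}$ be any enumeration (possibly with repetitions) of all pairs of finite sequences of addresses. Consider the following algorithm on an input $(T,T')$: for $n=0,1,2,\dots$, compute $T_1=\mathrm{Expand}(T,s_n)$ and $T_1'=\mathrm{Expand}(T',s_n')$ (go to $n+1$ if one of them is not defined); if $T_1=T_1'$, stop and return True; otherwise, if $\overline{T_1}=\overline{T_1'}$ or $\overline{T_1}\sqsubset\overline{T_1'}$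 or $\overline{T_1'}\sqsubset\overline{T_1}$, stop and return False; otherwise go to $n+1$. This algorithm terminates for all terms $T,T'$; it returns True if $T=_{LD}T'$ and False otherwise. (4) The word problem of left selfdistributivity is decidable for terms in any number of variables: if $X$ is effectively coded by natural numbers (in particular if $X$ is finite or $X=\{x_1,x_2,\dots\}$), there is a computable function that decides, from the Polish expressions of two terms $T,T'$ in $T_X$, whether $T=_{LD}T'$. -/

import Mathlib

/-! Terms in one binary operation with variables in `X` are the elements of the absolutely free
algebra `FreeMagma X`. -/

namespace SelfDist

universe u

/-- Addresses in binary trees: `false` is `0` (left), `true` is `1` (right). -/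
abbrev Address := List Bool

section Terms

variable {X : Type u}

/-- The instances of left selfdistributivity: all pairs
`(a * (b * c), (a * b) * (a * c))`. -/
inductive LDInstance : FreeMagma X → FreeMagma X → Prop
  | mk (a b c : FreeMagma X) : LDInstance (a * (b * c)) ((a * b) * (a * c))

/-- LD-equivalence: the congruence generated by the instances of left selfdistributivity. -/
def LDEquiv (s t : FreeMagma X) : Prop := conGen LDInstance s t

/-- The projection of a term to a term in one variable: every variable is mapped to the same
variable. -/
def proj (t : FreeMagma X) : FreeMagma Unit := FreeMagma.map (fun _ => ()) t

/-- The right Polish expression of a term, a word whose letters are the variables `some x` and the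
operation symbol `none`. -/
def polish : FreeMagma X → List (Option X)
  | .of x => [some x]
  | a * b => polish a ++ polish b ++ [none]

/-- The subterm of a term at an address, when it exists. -/
def subterm : FreeMagma X → Address → Option (FreeMagma X)
  | t, [] => some t
  | .of _, _ :: _ => none
  | a * _, false :: α => subterm a α
  | _ * b, true :: α => subterm b α

/-- The cut of a term at the address of a leaf; `none` if the address is not that of a leaf. -/
def cut : FreeMagma X → Address → Option (FreeMagma X)
  | .of x, [] => some (.of x)
  | .of _, _ :: _ => none
  | _ * _, [] => none
  | a * _, false :: α => cut a α
  | a * b, true :: α => (cut b α).map (fun c => a * c)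

/-- The cut at an address exists exactly when the address is that of a leaf. -/
theorem cut_isSome_iff (t : FreeMagma X) (α : Address) :
    (∃ c, cut t α = some c) ↔ ∃ x, subterm t α = some (.of x) := by
  induction t generalizing α with
  | ih1 x => cases α <;> simp [cut, subterm]
  | ih2 a b iha ihb =>
    rcases α with _ | ⟨_ | _, α⟩
    · simp only [cut, subterm, Option.some.injEq]
      constructor
      · rintro ⟨c, hc⟩
        cases hc
      · rintro ⟨x, hx⟩
        cases hx
    · simpa [cut, subterm] using iha α
    · simpa [cut, subterm] using ihb α

/-- The Polish expression of a cut is the prefix of the Polish expression of the term that finishes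
with the variable at the chosen leaf, completed by operation symbols. -/
theorem polish_cut {t c : FreeMagma X} {α : Address} {x : X}
    (hx : subterm t α = some (.of x)) (hc : cut t α = some c) :
    ∃ w v : List (Option X), ∃ p : ℕ, polish t = w ++ some x :: v ∧
      polish c = w ++ some x :: List.replicate p none := by
  induction t generalizing α c with
  | ih1 y =>
    cases α with
    | nil =>
      simp only [subterm, Option.some.injEq] at hx
      simp only [cut, Option.some.injEq] at hc
      cases hx
      cases hc
      exact ⟨[], [], 0, by simp [polish]⟩
    | cons i α => simp [cut] at hc
  | ih2 a b iha ihb =>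
    rcases α with _ | ⟨_ | _, α⟩
    · simp [cut] at hc
    · obtain ⟨w, v, p, h1, h2⟩ := iha (α := α) hx hc
      exact ⟨w, v ++ polish b ++ [none], p, by simp [polish, h1], h2⟩
    · simp only [cut, Option.map_eq_some_iff] at hc
      obtain ⟨d, hd, rfl⟩ := hc
      obtain ⟨w, v, p, h1, h2⟩ := ihb (α := α) hx hd
      exact ⟨polish a ++ w, v ++ [none], p + 1, by simp [polish, h1],
        by simp [polish, h2, List.replicate_succ']⟩

/-- The rightmost variable of a term. -/
def rightmost : FreeMagma X → X
  | .of x => x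
  | _ * b => rightmost b

/-- The term obtained by replacing the rightmost occurrence of a variable with the variable `y`. -/
def replaceRightmost (y : X) : FreeMagma X → FreeMagma X
  | .of _ => .of y
  | a * b => a * replaceRightmost y b

/-- Two terms coincide except in their rightmost variables, which are different. -/
def CoincideExceptRightmost (s t : FreeMagma X) : Prop :=
  rightmost s ≠ rightmost t ∧ replaceRightmost (rightmost t) s = t

/-- The left selfdistributivity law applied in the expanding direction at an address:
the subterm there, which has to be of the form `a * (b * c)`, is replaced with
`(a * b) * (a * c)`. -/
def expandAt : FreeMagma X → Address → Option (FreeMagma X)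
  | .of _, _ => none
  | _ * .of _, [] => none
  | a * (b * c), [] => some ((a * b) * (a * c))
  | a * b, false :: α => (expandAt a α).map (fun a' => a' * b)
  | a * b, true :: α => (expandAt b α).map (fun b' => a * b')

/-- The result of expanding a term successively at the addresses of a finite sequence, when it is
defined. -/
def expand (t : FreeMagma X) (s : List Address) : Option (FreeMagma X) :=
  s.foldlM expandAt t

end Terms

section Division

/-- `a` divides `b`. -/
def Divides {S : Type u} [Mul S] (a b : S) : Prop := ∃ x, a * x = b

/-- The transitive closure of division. On terms, it is the relation of being a proper iterated
left subterm. -/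
def DividesPlus {S : Type u} [Mul S] : S → S → Prop := Relation.TransGen Divides

variable {X : Type u}

theorem not_dividesPlus_of (s : FreeMagma X) (x : X) : ¬ DividesPlus s (.of x) := by
  intro h
  obtain ⟨_, _, ⟨y, hy⟩⟩ := (Relation.TransGen.tail'_iff).1 h
  cases hy

theorem dividesPlus_mul_iff (s a b : FreeMagma X) :
    DividesPlus s (a * b) ↔ s = a ∨ DividesPlus s a := by
  constructor
  · intro h
    obtain ⟨c, hc, ⟨y, hy⟩⟩ := (Relation.TransGen.tail'_iff).1 h
    cases hy
    rcases Relation.reflTransGen_iff_eq_or_transGen.1 hc with h | h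
    · exact Or.inl h.symm
    · exact Or.inr h
  · rintro (rfl | h)
    · exact .single ⟨b, rfl⟩
    · exact .tail h ⟨b, rfl⟩

instance decidableDividesPlus [DecidableEq X] (s : FreeMagma X) :
    (t : FreeMagma X) → Decidable (DividesPlus s t)
  | .of x => isFalse (not_dividesPlus_of s x)
  | a * b =>
    haveI := decidableDividesPlus s a
    decidable_of_iff' _ (dividesPlus_mul_iff s a b)

end Division

section Algorithm

variable {X : Type u} [DecidableEq X]

/-- The body of the loop of the syntactic algorithm for the input `(t, t')`, run with the pair of
sequences of addresses `s`: an answer, or `none` if the loop goes on, in particular when one of the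
two expansions is not defined. -/
def loopBody (t t' : FreeMagma X) (s : List Address × List Address) : Option Bool :=
  match expand t s.1, expand t' s.2 with
  | some t₁, some t₁' =>
    if t₁ = t₁' then some true
    else if proj t₁ = proj t₁' ∨ DividesPlus (proj t₁) (proj t₁') ∨
        DividesPlus (proj t₁') (proj t₁) then some false
    else none
  | _, _ => none

/-- The syntactic algorithm based on an enumeration `e` of the pairs of finite sequences of
addresses: run the body of the loop for `n = 0, 1, 2, …` and return the first answer. The result is
a partial value, undefined if the loop runs forever. -/
def syntacticAlgorithm (e : ℕ → List Address × List Address) (t t' : FreeMagma X) : Part Bool :=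
  Nat.rfindOpt fun n => loopBody t t' (e n)

end Algorithm

end SelfDist

/-!
Confluence: distributing `s` over the leaves of `t` gives a term `distr s t` that is an expansion of
`s * t`, and iterating this over the term gives the uniform expansion `derive t`, which is an
expansion of every one-step expansion of `t` (`Step.expands_derive`) and is monotone
(`Expands.derive`). Hence two terms are LD-equivalent exactly when they have a common expansion
(`ldEquiv_iff_exists_expands`).

Acyclicity: a proper iterated left subterm of `t` is never LD-equivalent to `t`
(`not_ldEquiv_of_dividesPlus`). It is enough to evaluate in an LD-system without cycles for left
division. In a group with an endomorphism `shift` and an element `sigma` satisfying the relations of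
the infinite braid group, the bracket `a * shift b * sigma * (shift a)⁻¹` is left selfdistributive.
Here the group consists of the permutations of the sequences of pairs of positive rationals, and
`sigma` is a subtraction-free form of Dynnikov's action of the braid generator. A shifted
permutation fixes the first entry of a sequence, and `sigma` strictly increases the first number of
that entry. A bracket is therefore its left factor times a permutation that strictly increases this
number, and products of such permutations are not the identity.

Comparison: every term in one variable divides all high right powers of the variable
(`exists_rightPower_ldEquiv`). As an expansion of a term contains an expansion of each iterated left
subterm, again as an iterated left subterm (`Expands.exists_dividesStar`), confluence gives any two
one-variable terms expansions that are comparable as iterated left subterms.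

A cut of `T` is an iterated left subterm of an expansion of `T` (`exists_expands_of_cut`). If `T` and
`T'` are LD-equivalent and have cuts `c`, `c'` with the same projection, then `c` and `c'` expand to
iterated left subterms of a single term; by acyclicity, applied to the projections, these are equal.
So `c` and `c'` are LD-equivalent and have the same rightmost variable, which LD-equivalence
preserves. Two different terms with the same projection have cuts that coincide except in their
rightmost variables, so they are not LD-equivalent. Thus every answer of the algorithm is correct,
and comparison makes it stop.

For computability the search is done on Polish words. Comparability of the projections becomes the
prefix relation between words with identified variables, and a certificate lists the factors
`a b c • •` of the words that are rewritten as `a b • a c • •`. Checking a certificate is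
primitive recursive, and every pair of words has a certificate.
-/

namespace SelfDist

universe u

section Confluence

variable {X : Type u}

/-! ### Expansions and confluence -/

/-- One application of left selfdistributivity in the expanding direction, at any address. -/
inductive Step : FreeMagma X → FreeMagma X → Prop
  | root (a b c : FreeMagma X) : Step (a * (b * c)) ((a * b) * (a * c))
  | left {a a' : FreeMagma X} (b : FreeMagma X) : Step a a' → Step (a * b) (a' * b)
  | right (a : FreeMagma X) {b b' : FreeMagma X} : Step b b' → Step (a * b) (a * b')

/-- `t` is an LD-expansion of `s`. -/
abbrev Expands : FreeMagma X → FreeMagma X → Prop := Relation.ReflTransGen Step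

theorem Expands.mul {a a' b b' : FreeMagma X} (ha : Expands a a') (hb : Expands b b') :
    Expands (a * b) (a' * b') :=
  (ha.lift (· * b) fun _ _ h => .left b h).trans (hb.lift (a' * ·) fun _ _ h => .right a' h)

/-- The term obtained by multiplying every leaf of `t` by `s` on the left. -/
def distr (s : FreeMagma X) : FreeMagma X → FreeMagma X
  | .of x => s * .of x
  | a * b => distr s a * distr s b

/-- The uniform expansion of a term, which is an expansion of all its one-step expansions. -/
def derive : FreeMagma X → FreeMagma X
  | .of x => .of x
  | a * b => distr (derive a) (derive b)

theorem mul_expands_distr (s t : FreeMagma X) : Expands (s * t) (distr s t) := by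
  induction t with
  | ih1 x => exact .refl
  | ih2 a b iha ihb => exact .head (.root s a b) (iha.mul ihb)

theorem distr_mono {s s' t t' : FreeMagma X} (hs : Expands s s') (ht : Expands t t') :
    Expands (distr s t) (distr s' t') := by
  have h1 : ∀ t, Expands (distr s t) (distr s' t) := by
    intro t
    induction t with
    | ih1 x => exact hs.mul .refl
    | ih2 a b iha ihb => exact iha.mul ihb
  refine (h1 t).trans (ht.lift (distr s') fun a b h => ?_)
  induction h with
  | root a b c => exact .root _ _ _
  | left b _ ih => exact .left _ ih
  | right a _ ih => exact .right _ ih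

theorem expands_derive (t : FreeMagma X) : Expands t (derive t) := by
  induction t with
  | ih1 x => exact .refl
  | ih2 a b iha ihb => exact (iha.mul ihb).trans (mul_expands_distr _ _)

theorem distr_mul_distr_expands (s a b : FreeMagma X) :
    Expands (distr s a * distr s b) (distr s (distr a b)) := by
  induction b with
  | ih1 x => exact .refl
  | ih2 b c ihb ihc => exact .head (.root _ _ _) (ihb.mul ihc)

theorem distr_distr_expands (s a b : FreeMagma X) :
    Expands (distr s (distr a b)) (distr (distr s a) (distr s b)) := by
  induction b with
  | ih1 x => exact mul_expands_distr _ _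
  | ih2 b c ihb ihc => exact ihb.mul ihc

theorem Step.expands_derive {s t : FreeMagma X} (h : Step s t) : Expands t (derive s) := by
  induction h with
  | root a b c =>
    have h (d e : FreeMagma X) : Expands (d * e) (distr (derive d) (derive e)) :=
      SelfDist.expands_derive (d * e)
    exact ((h a b).mul (h a c)).trans (distr_mul_distr_expands _ _ _)
  | left b _ ih => exact (ih.mul (SelfDist.expands_derive b)).trans (mul_expands_distr _ _)
  | right a _ ih => exact ((SelfDist.expands_derive a).mul ih).trans (mul_expands_distr _ _)

theorem Step.derive {s t : FreeMagma X} (h : Step s t) : Expands (derive s) (derive t) := by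
  induction h with
  | root a b c => exact distr_distr_expands _ _ _
  | left b _ ih => exact distr_mono ih .refl
  | right a _ ih => exact distr_mono .refl ih

theorem Expands.derive {s t : FreeMagma X} (h : Expands s t) :
    Expands (derive s) (derive t) := by
  induction h with
  | refl => exact .refl
  | tail _ h ih => exact ih.trans h.derive

/-- Confluence. When `t` is obtained from `s` in `k` steps, the common expansion that the proof
builds is the uniform expansion of `t'`, iterated `k` times. -/
theorem Expands.confluent {s t t' : FreeMagma X} (h : Expands s t) (h' : Expands s t') :
    ∃ v, Expands t v ∧ Expands t' v := by
  induction h with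
  | refl => exact ⟨t', h', .refl⟩
  | tail _ h ih =>
    obtain ⟨v, hv, hv'⟩ := ih
    exact ⟨SelfDist.derive v, h.expands_derive.trans hv.derive,
      hv'.trans (SelfDist.expands_derive v)⟩

theorem Step.ldEquiv {s t : FreeMagma X} (h : Step s t) : LDEquiv s t := by
  induction h with
  | root a b c => exact ConGen.Rel.of _ _ (.mk a b c)
  | left b _ ih => exact ConGen.Rel.mul ih (.refl b)
  | right a _ ih => exact ConGen.Rel.mul (.refl a) ih

theorem LDEquiv.refl (s : FreeMagma X) : LDEquiv s s := ConGen.Rel.refl s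

theorem LDEquiv.symm {s t : FreeMagma X} (h : LDEquiv s t) : LDEquiv t s := ConGen.Rel.symm h

theorem LDEquiv.trans {s t u : FreeMagma X} (h : LDEquiv s t) (h' : LDEquiv t u) :
    LDEquiv s u := ConGen.Rel.trans h h'

theorem LDEquiv.mul {a a' b b' : FreeMagma X} (h : LDEquiv a a') (h' : LDEquiv b b') :
    LDEquiv (a * b) (a' * b') := ConGen.Rel.mul h h'

theorem LDEquiv.distrib (a b c : FreeMagma X) :
    LDEquiv (a * (b * c)) ((a * b) * (a * c)) := (Step.root a b c).ldEquiv

theorem Expands.ldEquiv {s t : FreeMagma X} (h : Expands s t) : LDEquiv s t := by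
  induction h with
  | refl => exact .refl s
  | tail _ h ih => exact ih.trans h.ldEquiv

/-- Two terms are LD-equivalent exactly when they have a common expansion. -/
theorem ldEquiv_iff_exists_expands {s t : FreeMagma X} :
    LDEquiv s t ↔ ∃ v, Expands s v ∧ Expands t v := by
  refine ⟨fun h => ?_, fun ⟨v, hs, ht⟩ => hs.ldEquiv.trans ht.ldEquiv.symm⟩
  replace h : ConGen.Rel LDInstance s t := h
  induction h with
  | of _ _ h =>
    obtain ⟨a, b, c⟩ := h
    exact ⟨_, .single (.root a b c), .refl⟩
  | refl s => exact ⟨s, .refl, .refl⟩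
  | symm _ ih => obtain ⟨v, h1, h2⟩ := ih; exact ⟨v, h2, h1⟩
  | trans _ _ ih ih' =>
    obtain ⟨v, h1, h2⟩ := ih
    obtain ⟨w, h3, h4⟩ := ih'
    obtain ⟨z, h5, h6⟩ := h2.confluent h3
    exact ⟨z, h1.trans h5, h4.trans h6⟩
  | mul _ _ ih ih' =>
    obtain ⟨v, h1, h2⟩ := ih
    obtain ⟨w, h3, h4⟩ := ih'
    exact ⟨v * w, h1.mul h3, h2.mul h4⟩

/-- An LD-equivalence is an equality under every evaluation in an LD-system. -/
theorem LDEquiv.lift_eq {M : Type*} [Mul M] (hM : ∀ a b c : M, a * (b * c) = (a * b) * (a * c))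
    (f : X → M) {s t : FreeMagma X} (h : LDEquiv s t) :
    FreeMagma.lift f s = FreeMagma.lift f t := by
  replace h : ConGen.Rel LDInstance s t := h
  induction h with
  | of _ _ h =>
    obtain ⟨a, b, c⟩ := h
    simp only [map_mul]
    exact hM _ _ _
  | refl s => rfl
  | symm _ ih => exact ih.symm
  | trans _ _ ih ih' => exact ih.trans ih'
  | mul _ _ ih ih' => rw [map_mul, map_mul, ih, ih']

theorem LDEquiv.proj {s t : FreeMagma X} (h : LDEquiv s t) :
    LDEquiv (SelfDist.proj s) (SelfDist.proj t) := by
  replace h : ConGen.Rel LDInstance s t := h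
  induction h with
  | of _ _ h =>
    obtain ⟨a, b, c⟩ := h
    exact .distrib _ _ _
  | refl s => exact .refl _
  | symm _ ih => exact ih.symm
  | trans _ _ ih ih' => exact ih.trans ih'
  | mul _ _ ih ih' => exact ih.mul ih'

theorem rightmost_eq_of_ldEquiv {s t : FreeMagma X} (h : LDEquiv s t) :
    rightmost s = rightmost t := by
  replace h : ConGen.Rel LDInstance s t := h
  induction h with
  | of _ _ h => obtain ⟨a, b, c⟩ := h; rfl
  | refl s => rfl
  | symm _ ih => exact ih.symm
  | trans _ _ ih ih' => exact ih.trans ih'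
  | mul _ _ ih ih' => exact ih'

end Confluence

/-! ### A birational solution of the braid relation -/

/-- A pair of positive rational numbers, the colour of one strand of a braid. -/
@[ext]
structure PosPair where
  /-- The number that a crossing increases in the left position. -/
  x : ℚ
  /-- The number whose product over two strands is preserved by their crossing. -/
  y : ℚ
  x_pos : 0 < x
  y_pos : 0 < y

namespace PosPair

/-- An expression that occurs in both colours after a crossing. -/
def mix (p q : PosPair) : ℚ := q.x * p.y + p.x * (1 + p.y) * (1 + q.y)

theorem mix_pos (p q : PosPair) : 0 < mix p q := by
  have := p.x_pos; have := p.y_pos; have := q.x_pos; have := q.y_pos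
  unfold mix
  positivity

/-- The left colour after a crossing of two strands coloured `p` and `q`. The pair
`(crossLeft p q, crossRight p q)` is Dynnikov's piecewise linear action of a braid generator on
curve diagrams, with maxima, sums and differences replaced by sums, products and quotients. In this
form the monotonicity of the first number is strict. -/
def crossLeft (p q : PosPair) : PosPair where
  x := p.x + p.y * (p.x + q.x)
  y := p.y * q.y * q.x / mix p q
  x_pos := by have := p.x_pos; have := p.y_pos; have := q.x_pos; positivity
  y_pos := by
    have := p.y_pos; have := q.x_pos; have := q.y_pos; have := mix_pos p q; positivity

/-- The right colour after a crossing of two strands coloured `p` and `q`. -/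
def crossRight (p q : PosPair) : PosPair where
  x := p.x * q.x * q.y / (q.x + p.x * (1 + q.y))
  y := mix p q / q.x
  x_pos := by have := p.x_pos; have := q.x_pos; have := q.y_pos; positivity
  y_pos := by have := q.x_pos; have := mix_pos p q; positivity

/-- The involution that inverts the first number. Conjugation by it inverts a crossing. -/
def flip (p : PosPair) : PosPair where
  x := p.x⁻¹
  y := p.y
  x_pos := inv_pos.2 p.x_pos
  y_pos := p.y_pos

theorem flip_flip (p : PosPair) : p.flip.flip = p := by
  ext <;> simp [flip]

theorem flip_crossLeft (p q : PosPair) :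
    (crossLeft (crossLeft p q).flip (crossRight p q).flip).flip = p := by
  have := p.x_pos; have := p.y_pos; have := q.x_pos; have := q.y_pos
  ext <;> simp only [flip, crossLeft, crossRight, mix] <;> field_simp <;> ring

theorem flip_crossRight (p q : PosPair) :
    (crossRight (crossLeft p q).flip (crossRight p q).flip).flip = q := by
  have := p.x_pos; have := p.y_pos; have := q.x_pos; have := q.y_pos
  ext <;> simp only [flip, crossLeft, crossRight, mix] <;> field_simp <;> ring

theorem x_lt_crossLeft_x (p q : PosPair) : p.x < (crossLeft p q).x := by
  have := p.x_pos; have := p.y_pos; have := q.x_pos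
  simp only [crossLeft]
  exact lt_add_of_pos_right _ (by positivity)

theorem crossLeft_x (p q : PosPair) : (crossLeft p q).x = p.x + p.y * (p.x + q.x) := rfl

theorem crossLeft_y (p q : PosPair) : (crossLeft p q).y = p.y * q.y * q.x / mix p q := rfl

theorem crossRight_x (p q : PosPair) :
    (crossRight p q).x = p.x * q.x * q.y / (q.x + p.x * (1 + q.y)) := rfl

theorem crossRight_y (p q : PosPair) : (crossRight p q).y = mix p q / q.x := rfl

theorem one_add_crossRight_y (p q : PosPair) :
    1 + (crossRight p q).y = (1 + p.y) * (q.x + p.x * (1 + q.y)) / q.x := by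
  have := q.x_pos
  rw [crossRight_y, mix]
  field_simp
  ring

theorem one_add_crossLeft_y (p q : PosPair) :
    1 + (crossLeft p q).y = (1 + q.y) * (p.x * (1 + p.y) + p.y * q.x) / mix p q := by
  have := p.x_pos; have := p.y_pos; have := q.x_pos; have := q.y_pos
  rw [crossLeft_y, mix]
  field_simp
  ring

/-! The three positions of the braid relation are compared through closed forms of both sides.
The denominators that occur factor only after the intermediate values are put in lowest terms,
which is what the next lemmas do. -/

theorem crossLeft_crossRight_x (p q r : PosPair) : (crossLeft (crossRight p q) r).x =
    (p.x * q.y * q.x * (1 + p.y) + mix p q * r.x) / q.x := by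
  have := p.x_pos; have := p.y_pos; have := q.x_pos; have := q.y_pos
  rw [crossLeft_x, crossRight_x, crossRight_y, mix]
  field_simp
  ring

/-- The common denominator of the values computed from `crossLeft (crossRight p q) r`. -/
def mixRight (p q r : PosPair) : ℚ :=
  r.x * mix p q + p.x * q.x * q.y * (1 + p.y) * (1 + r.y)

/-- The common denominator of the values computed from `crossRight p (crossLeft q r)`. -/
def mixLeft (p q r : PosPair) : ℚ := p.y * mix q r + p.x * (1 + p.y) * (1 + r.y)

theorem crossLeft_crossRight_y (p q r : PosPair) : (crossLeft (crossRight p q) r).y =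
    mix p q * r.x * r.y / mixRight p q r := by
  have := p.x_pos; have := p.y_pos; have := q.x_pos; have := q.y_pos
  have := r.x_pos; have := r.y_pos
  rw [crossLeft_y, mix, one_add_crossRight_y, crossRight_x, crossRight_y, mixRight, mix]
  field_simp

theorem one_add_crossLeft_crossRight_y (p q r : PosPair) :
    1 + (crossLeft (crossRight p q) r).y =
      (1 + r.y) * (p.x * q.y * q.x * (1 + p.y) + mix p q * r.x) / mixRight p q r := by
  have := p.x_pos; have := p.y_pos; have := q.x_pos; have := q.y_pos
  have := r.x_pos; have := r.y_pos
  rw [crossLeft_crossRight_y, mixRight, mix]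
  field_simp
  ring

theorem crossRight_crossLeft_x (p q r : PosPair) : (crossRight p (crossLeft q r)).x =
    p.x * q.y * r.x * r.y / (mix q r + p.x * (1 + r.y)) := by
  have := p.x_pos; have := q.x_pos; have := q.y_pos; have := r.x_pos; have := r.y_pos
  rw [crossRight_x, crossLeft_x, crossLeft_y, mix]
  field_simp
  ring

theorem crossRight_crossLeft_y (p q r : PosPair) :
    (crossRight p (crossLeft q r)).y = mixLeft p q r / mix q r := by
  have := p.x_pos; have := q.x_pos; have := q.y_pos; have := r.x_pos; have := r.y_pos
  rw [crossRight_y, mix, one_add_crossLeft_y, crossLeft_x, mixLeft, mix]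
  field_simp
  ring

theorem one_add_crossRight_crossLeft_y (p q r : PosPair) :
    1 + (crossRight p (crossLeft q r)).y =
      (1 + p.y) * (mix q r + p.x * (1 + r.y)) / mix q r := by
  have := q.x_pos; have := q.y_pos; have := r.x_pos; have := r.y_pos
  rw [crossRight_crossLeft_y, mixLeft, mix]
  field_simp
  ring

theorem braid_left (p q r : PosPair) :
    crossLeft (crossLeft p q) (crossLeft (crossRight p q) r) = crossLeft p (crossLeft q r) := by
  have := p.x_pos; have := p.y_pos; have := q.x_pos; have := q.y_pos
  have := r.x_pos; have := r.y_pos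
  ext
  · rw [crossLeft_x, crossLeft_crossRight_x]
    simp only [crossLeft_x, crossLeft_y, mix]
    field_simp
    ring
  · trans p.y * q.y * r.x * r.y / mixLeft p q r
    · rw [crossLeft_y, mix, one_add_crossLeft_crossRight_y, one_add_crossLeft_y,
        crossLeft_crossRight_x, crossLeft_crossRight_y, crossLeft_x, crossLeft_y, mixRight,
        mixLeft, mix, mix]
      field_simp
      ring
    · rw [crossLeft_y, mix, one_add_crossLeft_y, crossLeft_x, crossLeft_y, mixLeft, mix]
      field_simp
      ring

theorem braid_middle (p q r : PosPair) :
    crossRight (crossLeft p q) (crossLeft (crossRight p q) r) =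
      crossLeft (crossRight p (crossLeft q r)) (crossRight q r) := by
  have := p.x_pos; have := p.y_pos; have := q.x_pos; have := q.y_pos
  have := r.x_pos; have := r.y_pos
  ext
  · trans (p.x * (1 + p.y) + p.y * q.x) * r.x * r.y / (r.x + q.x * (1 + r.y))
    · rw [crossRight_x, one_add_crossLeft_crossRight_y, crossLeft_crossRight_x,
        crossLeft_crossRight_y, crossLeft_x, mixRight, mix]
      field_simp
      ring
    · rw [crossLeft_x, crossRight_crossLeft_x, crossRight_crossLeft_y, crossRight_x, mixLeft, mix]
      field_simp
      ring
  · trans q.x * mixLeft p q r / mixRight p q r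
    · rw [crossRight_y, mix, one_add_crossLeft_crossRight_y, one_add_crossLeft_y,
        crossLeft_crossRight_x, crossLeft_x, crossLeft_y, mixLeft, mixRight, mix, mix]
      field_simp
      ring
    · rw [crossLeft_y, mix, one_add_crossRight_crossLeft_y, one_add_crossRight_y,
        crossRight_crossLeft_x, crossRight_crossLeft_y, crossRight_x, crossRight_y, mixLeft,
        mixRight, mix, mix]
      field_simp
      ring

theorem braid_right (p q r : PosPair) :
    crossRight (crossRight p q) r =
      crossRight (crossRight p (crossLeft q r)) (crossRight q r) := by
  have := p.x_pos; have := p.y_pos; have := q.x_pos; have := q.y_pos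
  have := r.x_pos; have := r.y_pos
  ext
  · rw [crossRight_x, crossRight_x, crossRight_x _ (crossRight q r), one_add_crossRight_y,
      crossRight_crossLeft_x, crossRight_x, crossRight_y, mix]
    field_simp
    ring
  · trans mixRight p q r / (q.x * r.x)
    · rw [crossRight_y, mix, one_add_crossRight_y, crossRight_x, crossRight_y, mixRight, mix]
      field_simp
    · rw [crossRight_y, mix, one_add_crossRight_crossLeft_y, one_add_crossRight_y,
        crossRight_crossLeft_x, crossRight_crossLeft_y, crossRight_x, mixLeft, mixRight, mix, mix]
      field_simp
      ring

end PosPair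

/-! ### An LD-system with acyclic left division -/

/-- The colourings of infinitely many strands. -/
abbrev Colouring : Type := ℕ → PosPair

namespace Colouring

/-- The colouring `s` shifted by one strand, after a first strand coloured `p`. -/
def cons (p : PosPair) (s : Colouring) : Colouring
  | 0 => p
  | n + 1 => s n

/-- The colouring without its first strand. -/
def tail (s : Colouring) : Colouring := fun n => s (n + 1)

theorem cons_tail (s : Colouring) : cons (s 0) s.tail = s := by
  funext n
  cases n <;> rfl

/-- A crossing of the first two strands. -/
def cross (s : Colouring) : Colouring :=
  cons (.crossLeft (s 0) (s 1)) (cons (.crossRight (s 0) (s 1)) s.tail.tail)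

/-- The involution that inverts the first number of every colour. -/
def flip (s : Colouring) : Colouring := fun n => (s n).flip

theorem flip_flip (s : Colouring) : s.flip.flip = s := funext fun n => (s n).flip_flip

theorem flip_cross_flip_cross (s : Colouring) : s.cross.flip.cross.flip = s := by
  funext n
  match n with
  | 0 => exact PosPair.flip_crossLeft _ _
  | 1 => exact PosPair.flip_crossRight _ _
  | n + 2 => exact PosPair.flip_flip _

/-- The crossing of the first two strands, as a permutation of the colourings. -/
def sigma : Equiv.Perm Colouring where
  toFun := cross
  invFun s := s.flip.cross.flip
  left_inv := flip_cross_flip_cross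
  right_inv s := by
    have h := congrArg flip (flip_cross_flip_cross s.flip)
    rwa [flip_flip, flip_flip] at h

/-- The action of a permutation of the colourings on all strands but the first. -/
def shift : Equiv.Perm Colouring →* Equiv.Perm Colouring where
  toFun f :=
    { toFun := fun s => cons (s 0) (f s.tail)
      invFun := fun s => cons (s 0) (f.symm s.tail)
      left_inv := fun s => by
        change cons (s 0) (f.symm (f s.tail)) = s
        rw [f.symm_apply_apply, cons_tail]
      right_inv := fun s => by
        change cons (s 0) (f (f.symm s.tail)) = s
        rw [f.apply_symm_apply, cons_tail] }
  map_one' := Equiv.ext fun s => cons_tail s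
  map_mul' _ _ := rfl

theorem sigma_mul_shift_shift (f : Equiv.Perm Colouring) :
    sigma * shift (shift f) = shift (shift f) * sigma := by
  ext1 s
  funext n
  match n with
  | 0 | 1 | n + 2 => rfl

theorem sigma_braid : sigma * shift sigma * sigma = shift sigma * sigma * shift sigma := by
  ext1 s
  funext n
  match n with
  | 0 => exact PosPair.braid_left _ _ _
  | 1 => exact PosPair.braid_middle _ _ _
  | 2 => exact PosPair.braid_right _ _ _
  | n + 3 => rfl

/-- Dehornoy's bracket, the operation of the braid group that is left selfdistributive. -/
def bracket (a b : Equiv.Perm Colouring) : Equiv.Perm Colouring :=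
  a * shift b * sigma * (shift a)⁻¹

theorem bracket_distrib (a b c : Equiv.Perm Colouring) :
    bracket a (bracket b c) = bracket (bracket a b) (bracket a c) := by
  have h1 := sigma_mul_shift_shift
  have h2 : sigma * shift sigma * sigma * (shift sigma)⁻¹ = shift sigma * sigma := by
    rw [sigma_braid, mul_inv_cancel_right]
  have h3 : sigma * (shift (shift b))⁻¹ = (shift (shift b))⁻¹ * sigma := by
    rw [← map_inv, ← map_inv, h1]
  have h4 : sigma * (shift (shift a))⁻¹ = (shift (shift a))⁻¹ * sigma := by
    rw [← map_inv, ← map_inv, h1]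
  simp only [bracket, map_mul, map_inv, mul_inv_rev, inv_inv]
  calc a * (shift b * shift (shift c) * shift sigma * (shift (shift b))⁻¹) * sigma * (shift a)⁻¹
      = a * shift b * shift (shift c) * shift sigma * ((shift (shift b))⁻¹ * sigma) *
          (shift a)⁻¹ := by group
    _ = a * shift b * shift (shift c) * (shift sigma * sigma) * (shift (shift b))⁻¹ *
          (shift a)⁻¹ := by rw [← h3]; group
    _ = a * shift b * (shift (shift c) * sigma) * shift sigma * sigma * (shift sigma)⁻¹ *
          (shift (shift b))⁻¹ * (shift a)⁻¹ := by rw [← h2]; group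
    _ = a * shift b * sigma * shift (shift c) * shift sigma *
          ((shift (shift a))⁻¹ * sigma) * shift (shift a) * (shift sigma)⁻¹ *
          (shift (shift b))⁻¹ * (shift a)⁻¹ := by rw [← h1, ← h4]; group
    _ = _ := by group

/-- A permutation of the colourings that increases the first number of the first strand. -/
def Increasing (f : Equiv.Perm Colouring) : Prop := ∀ s : Colouring, (s 0).x < (f s 0).x

theorem Increasing.mul {f g : Equiv.Perm Colouring} (hf : Increasing f) (hg : Increasing g) :
    Increasing (f * g) := fun s => (hg s).trans (hf (g s))

theorem not_increasing_one : ¬ Increasing 1 :=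
  fun h => lt_irrefl _ (h fun _ => ⟨1, 1, one_pos, one_pos⟩)

theorem increasing_sigma : Increasing sigma := fun _ => PosPair.x_lt_crossLeft_x _ _

theorem Increasing.shift_mul_mul_shift {f : Equiv.Perm Colouring} (hf : Increasing f)
    (a b : Equiv.Perm Colouring) : Increasing (shift a * f * shift b) :=
  fun s => hf (shift b s)

end Colouring

/-- The permutations of the colourings, as an LD-system under the bracket. -/
structure BraidSystem where
  /-- The underlying permutation. -/
  perm : Equiv.Perm Colouring

namespace BraidSystem

instance : Mul BraidSystem := ⟨fun a b => ⟨Colouring.bracket a.perm b.perm⟩⟩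

theorem distrib (a b c : BraidSystem) : a * (b * c) = (a * b) * (a * c) :=
  congrArg mk (Colouring.bracket_distrib a.perm b.perm c.perm)

theorem exists_increasing_of_divides {a b : BraidSystem} (h : Divides a b) :
    ∃ f : Equiv.Perm Colouring, Colouring.Increasing f ∧ b.perm = a.perm * f := by
  obtain ⟨c, rfl⟩ := h
  refine ⟨_, Colouring.increasing_sigma.shift_mul_mul_shift c.perm a.perm⁻¹, ?_⟩
  change Colouring.bracket a.perm c.perm = _
  simp only [Colouring.bracket, map_inv, mul_assoc]

theorem exists_increasing_of_dividesPlus {a b : BraidSystem} (h : DividesPlus a b) :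
    ∃ f : Equiv.Perm Colouring, Colouring.Increasing f ∧ b.perm = a.perm * f := by
  induction h with
  | single h => exact exists_increasing_of_divides h
  | tail _ h ih =>
    obtain ⟨f, hf, h1⟩ := ih
    obtain ⟨g, hg, h2⟩ := exists_increasing_of_divides h
    exact ⟨f * g, hf.mul hg, by rw [h2, h1, mul_assoc]⟩

theorem not_dividesPlus_self (a : BraidSystem) : ¬ DividesPlus a a := by
  intro h
  obtain ⟨f, hf, h⟩ := exists_increasing_of_dividesPlus h
  rw [left_eq_mul.1 h] at hf
  exact Colouring.not_increasing_one hf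

end BraidSystem

/-- Acyclicity: a proper iterated left subterm is not LD-equivalent to the term. -/
theorem not_ldEquiv_of_dividesPlus {X : Type u} {s t : FreeMagma X} (h : DividesPlus s t) :
    ¬ LDEquiv s t := by
  intro he
  let φ : FreeMagma X →ₙ* BraidSystem := FreeMagma.lift fun _ => ⟨1⟩
  have h' : DividesPlus (φ s) (φ t) :=
    Relation.TransGen.lift φ (fun a b ⟨c, hc⟩ => ⟨φ c, by rw [← hc, map_mul]⟩) s t h
  rw [show φ s = φ t from he.lift_eq BraidSystem.distrib _] at h'
  exact BraidSystem.not_dividesPlus_self _ h'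

section Comparison

variable {X : Type u}

/-! ### Iterated left subterms and cuts -/

/-- The reflexive closure of `DividesPlus`: on terms, being an iterated left subterm. -/
def DividesStar (s t : FreeMagma X) : Prop := s = t ∨ DividesPlus s t

theorem DividesStar.refl (s : FreeMagma X) : DividesStar s s := .inl rfl

theorem dividesStar_mul_iff {s a b : FreeMagma X} :
    DividesStar s (a * b) ↔ s = a * b ∨ DividesStar s a :=
  or_congr_right (dividesPlus_mul_iff s a b)

theorem DividesStar.mul_right {s a : FreeMagma X} (h : DividesStar s a) (b : FreeMagma X) :
    DividesStar s (a * b) := dividesStar_mul_iff.2 (.inr h)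

theorem DividesStar.comparable {s t w : FreeMagma X} (hs : DividesStar s w)
    (ht : DividesStar t w) : s = t ∨ DividesPlus s t ∨ DividesPlus t s := by
  rcases hs with rfl | hs
  · exact ht.imp Eq.symm .inr
  rcases ht with rfl | ht
  · exact .inr (.inl hs)
  induction w with
  | ih1 x => exact absurd hs (not_dividesPlus_of _ _)
  | ih2 a b iha _ =>
    rcases (dividesPlus_mul_iff _ _ _).1 hs with rfl | hs
    · exact ((dividesPlus_mul_iff _ _ _).1 ht).imp Eq.symm .inr
    rcases (dividesPlus_mul_iff _ _ _).1 ht with rfl | ht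
    · exact .inr (.inl hs)
    · exact iha hs ht

theorem Step.exists_dividesStar {s t t' : FreeMagma X} (h : Step t t') (hs : DividesStar s t) :
    ∃ s', Expands s s' ∧ DividesStar s' t' := by
  induction h with
  | root a b c =>
    rcases dividesStar_mul_iff.1 hs with rfl | hs
    · exact ⟨_, .single (.root a b c), .refl _⟩
    · exact ⟨s, .refl, (hs.mul_right b).mul_right _⟩
  | left b h ih =>
    rcases dividesStar_mul_iff.1 hs with rfl | hs
    · exact ⟨_, .single (.left b h), .refl _⟩
    · obtain ⟨s', h1, h2⟩ := ih hs
      exact ⟨s', h1, h2.mul_right b⟩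
  | right a h _ =>
    rcases dividesStar_mul_iff.1 hs with rfl | hs
    · exact ⟨_, .single (.right a h), .refl _⟩
    · exact ⟨s, .refl, hs.mul_right _⟩

/-- An expansion of a term contains an expansion of each iterated left subterm, again as an
iterated left subterm. -/
theorem Expands.exists_dividesStar {s t t' : FreeMagma X} (h : Expands t t')
    (hs : DividesStar s t) : ∃ s', Expands s s' ∧ DividesStar s' t' := by
  induction h with
  | refl => exact ⟨s, .refl, hs⟩
  | tail _ h ih =>
    obtain ⟨s', h1, h2⟩ := ih
    obtain ⟨s'', h3, h4⟩ := h.exists_dividesStar h2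
    exact ⟨s'', h1.trans h3, h4⟩

/-- Iterated left subterms of LD-equivalent terms have expansions that are equal or related by
being a proper iterated left subterm. -/
theorem LDEquiv.exists_comparable {s s' t t' : FreeMagma X} (h : LDEquiv t t')
    (hs : DividesStar s t) (hs' : DividesStar s' t') :
    ∃ v v', Expands s v ∧ Expands s' v' ∧ (v = v' ∨ DividesPlus v v' ∨ DividesPlus v' v) := by
  obtain ⟨w, h1, h2⟩ := ldEquiv_iff_exists_expands.1 h
  obtain ⟨v, h3, h4⟩ := h1.exists_dividesStar hs
  obtain ⟨v', h5, h6⟩ := h2.exists_dividesStar hs'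
  exact ⟨v, v', h3, h5, h4.comparable h6⟩

theorem exists_expands_mul_left {b d : FreeMagma X} (a : FreeMagma X) (h : DividesStar d b) :
    ∃ t, Expands (a * b) t ∧ DividesStar (a * d) t := by
  induction b with
  | ih1 x =>
    rcases h with rfl | h
    · exact ⟨_, .refl, .refl _⟩
    · exact absurd h (not_dividesPlus_of _ _)
  | ih2 b c ihb _ =>
    rcases dividesStar_mul_iff.1 h with rfl | h
    · exact ⟨_, .refl, .refl _⟩
    · obtain ⟨t, h1, h2⟩ := ihb h
      exact ⟨t * (a * c), .head (.root a b c) (h1.mul .refl), h2.mul_right _⟩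

/-- Every cut of a term is an iterated left subterm of an expansion of the term. -/
theorem exists_expands_of_cut {t c : FreeMagma X} {α : Address} (h : cut t α = some c) :
    ∃ t', Expands t t' ∧ DividesStar c t' := by
  induction t generalizing α c with
  | ih1 x =>
    cases α with
    | nil => cases h; exact ⟨_, .refl, .refl _⟩
    | cons i α => cases h
  | ih2 a b iha ihb =>
    rcases α with _ | ⟨_ | _, α⟩
    · cases h
    · obtain ⟨a', h1, h2⟩ := iha (α := α) h
      exact ⟨a' * b, h1.mul .refl, h2.mul_right b⟩
    · simp only [cut, Option.map_eq_some_iff] at h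
      obtain ⟨d, hd, rfl⟩ := h
      obtain ⟨b', h1, h2⟩ := ihb hd
      obtain ⟨t, h3, h4⟩ := exists_expands_mul_left a h2
      exact ⟨t, (Expands.mul .refl h1).trans h3, h4⟩

theorem proj_mul (a b : FreeMagma X) : proj (a * b) = proj a * proj b := rfl

theorem proj_replaceRightmost (y : X) (t : FreeMagma X) :
    proj (replaceRightmost y t) = proj t := by
  induction t with
  | ih1 x => rfl
  | ih2 a b _ ihb => exact congrArg (proj a * ·) ihb

theorem DividesPlus.proj {s t : FreeMagma X} (h : DividesPlus s t) :
    DividesPlus (SelfDist.proj s) (SelfDist.proj t) :=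
  Relation.TransGen.lift SelfDist.proj
    (fun a b ⟨c, hc⟩ => ⟨SelfDist.proj c, by rw [← hc, proj_mul]⟩) s t h

theorem not_ldEquiv_of_cut {T T' : FreeMagma X} {α α' : Address} {c c' : FreeMagma X}
    (hc : cut T α = some c) (hc' : cut T' α' = some c') (h : CoincideExceptRightmost c c') :
    ¬ LDEquiv T T' := by
  intro he
  obtain ⟨hne, heq⟩ := h
  obtain ⟨V, h1, h2⟩ := exists_expands_of_cut hc
  obtain ⟨V', h1', h2'⟩ := exists_expands_of_cut hc'
  obtain ⟨C, C', h3, h3', h4⟩ :=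
    ((h1.ldEquiv.symm.trans he).trans h1'.ldEquiv).exists_comparable h2 h2'
  have hproj : LDEquiv (proj C) (proj C') := by
    have h5 : proj c' = proj c := by rw [← heq, proj_replaceRightmost]
    refine h3.ldEquiv.proj.symm.trans ?_
    rw [← h5]
    exact h3'.ldEquiv.proj
  rcases h4 with rfl | h4 | h4
  · exact hne (rightmost_eq_of_ldEquiv (h3.ldEquiv.trans h3'.ldEquiv.symm))
  · exact not_ldEquiv_of_dividesPlus h4.proj hproj
  · exact not_ldEquiv_of_dividesPlus h4.proj hproj.symm

/-- Different terms with the same projection differ for the first time at some leaf, and the cuts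
there coincide except in their rightmost variables. -/
theorem exists_cut_of_proj_eq {T T' : FreeMagma X} (h : proj T = proj T') (hne : T ≠ T') :
    ∃ α c c', cut T α = some c ∧ cut T' α = some c' ∧ CoincideExceptRightmost c c' := by
  induction T generalizing T' with
  | ih1 x =>
    cases T' with
    | of y => exact ⟨[], _, _, rfl, rfl, fun hxy => hne (congrArg _ hxy), rfl⟩
    | mul a b => cases h
  | ih2 a b iha ihb =>
    cases T' with
    | of y => cases h
    | mul a' b' =>
      have ha : proj a = proj a' := congrArg (fun | .mul s _ => s | t => t) h
      have hb : proj b = proj b' := congrArg (fun | .mul _ s => s | t => t) h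
      by_cases haa : a = a'
      · subst haa
        obtain ⟨α, c, c', h1, h2, h3, h4⟩ := ihb hb fun hbb => hne (congrArg (a * ·) hbb)
        exact ⟨true :: α, a * c, a * c', congrArg (Option.map (a * ·)) h1,
          congrArg (Option.map (a * ·)) h2, h3, congrArg (a * ·) h4⟩
      · obtain ⟨α, c, c', h1, h2, h3⟩ := iha ha haa
        exact ⟨false :: α, c, c', h1, h2, h3⟩

theorem ldEquiv_iff_eq_of_proj_eq {T T' : FreeMagma X} (h : proj T = proj T') :
    LDEquiv T T' ↔ T = T' := by
  refine ⟨fun he => by_contra fun hne => ?_, fun he => he ▸ .refl T⟩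
  obtain ⟨α, c, c', h1, h2, h3⟩ := exists_cut_of_proj_eq h hne
  exact not_ldEquiv_of_cut h1 h2 h3 he

/-! ### Comparison of one-variable terms -/

/-- The right powers `x`, `x * x`, `x * (x * x)`, … of the variable. -/
def rightPower : ℕ → FreeMagma Unit
  | 0 => .of ()
  | n + 1 => .of () * rightPower n

/-- High right powers of the variable absorb any term. -/
theorem exists_rightPower_ldEquiv (t : FreeMagma Unit) :
    ∃ m, ∀ n ≥ m, LDEquiv (t * rightPower n) (rightPower (n + 1)) := by
  induction t with
  | ih1 x => exact ⟨0, fun n _ => .refl _⟩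
  | ih2 a b iha ihb =>
    obtain ⟨k, hk⟩ := iha
    obtain ⟨l, hl⟩ := ihb
    refine ⟨max k l + 1, fun n hn => ?_⟩
    obtain ⟨n, rfl⟩ : ∃ m, n = m + 1 := ⟨n - 1, by omega⟩
    have h1 := hk n (by omega)
    have h2 := hk (n + 1) (by omega)
    have h3 := hl n (by omega)
    -- `(a * b) * p ~ (a * b) * (a * p') ~ a * (b * p') ~ a * p`, where `p = x * p'`
    exact (((LDEquiv.refl _).mul h1.symm).trans (LDEquiv.distrib a b _).symm).trans
      (((LDEquiv.refl a).mul h3).trans h2)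

/-- Any two one-variable terms have expansions that are comparable as iterated left subterms. -/
theorem exists_expands_comparable (s t : FreeMagma Unit) :
    ∃ s' t', Expands s s' ∧ Expands t t' ∧
      (s' = t' ∨ DividesPlus s' t' ∨ DividesPlus t' s') := by
  obtain ⟨k, hk⟩ := exists_rightPower_ldEquiv s
  obtain ⟨l, hl⟩ := exists_rightPower_ldEquiv t
  exact ((hk (max k l) (le_max_left _ _)).trans (hl (max k l) (le_max_right _ _)).symm)
    |>.exists_comparable ((DividesStar.refl s).mul_right _) ((DividesStar.refl t).mul_right _)

/-! ### The syntactic algorithm -/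

theorem step_of_expandAt {t t' : FreeMagma X} {α : Address} (h : expandAt t α = some t') :
    Step t t' := by
  induction t, α using expandAt.induct generalizing t' with
  | case1 => cases h
  | case2 => cases h
  | case3 a b c => cases h; exact .root a b c
  | case4 a b α ih =>
    rw [expandAt, Option.map_eq_some_iff] at h
    obtain ⟨a', h, rfl⟩ := h
    exact .left b (ih h)
  | case5 a b α ih =>
    rw [expandAt, Option.map_eq_some_iff] at h
    obtain ⟨b', h, rfl⟩ := h
    exact .right a (ih h)

theorem Step.exists_expandAt {t t' : FreeMagma X} (h : Step t t') :
    ∃ α, expandAt t α = some t' := by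
  induction h with
  | root a b c => exact ⟨[], rfl⟩
  | left b _ ih =>
    obtain ⟨α, h⟩ := ih
    exact ⟨false :: α, (expandAt.eq_4 _ b α).trans (by rw [h]; rfl)⟩
  | right a _ ih =>
    obtain ⟨α, h⟩ := ih
    exact ⟨true :: α, (expandAt.eq_5 a _ α).trans (by rw [h]; rfl)⟩

theorem expands_of_expand {t t' : FreeMagma X} {s : List Address} (h : expand t s = some t') :
    Expands t t' := by
  induction s generalizing t with
  | nil => cases h; exact .refl
  | cons α s ih =>
    simp only [expand, List.foldlM_cons, Option.bind_eq_bind, Option.bind_eq_some_iff] at h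
    obtain ⟨u, h1, h2⟩ := h
    exact .head (step_of_expandAt h1) (ih h2)

theorem Expands.exists_expand {t t' : FreeMagma X} (h : Expands t t') :
    ∃ s, expand t s = some t' := by
  induction h using Relation.ReflTransGen.head_induction_on with
  | refl => exact ⟨[], rfl⟩
  | head h _ ih =>
    obtain ⟨α, hα⟩ := h.exists_expandAt
    obtain ⟨s, hs⟩ := ih
    refine ⟨α :: s, ?_⟩
    simp only [expand, List.foldlM_cons, hα]
    exact hs

theorem exists_step_of_proj {t : FreeMagma X} {v : FreeMagma Unit} (h : Step (proj t) v) :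
    ∃ t', Step t t' ∧ proj t' = v := by
  generalize hs : proj t = s at h
  induction h generalizing t with
  | root a b c =>
    rcases t with x | ⟨t₁, y | ⟨t₂, t₃⟩⟩
    · cases hs
    · cases hs
    · cases hs
      exact ⟨_, .root t₁ t₂ t₃, rfl⟩
  | left b _ ih =>
    rcases t with x | ⟨t₁, t₂⟩
    · cases hs
    · cases hs
      obtain ⟨t', h1, h2⟩ := ih rfl
      exact ⟨t' * t₂, .left t₂ h1, congrArg (· * proj t₂) h2⟩
  | right a _ ih =>
    rcases t with x | ⟨t₁, t₂⟩
    · cases hs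
    · cases hs
      obtain ⟨t', h1, h2⟩ := ih rfl
      exact ⟨t₁ * t', .right t₁ h1, congrArg (proj t₁ * ·) h2⟩

/-- The expansions of the projection of a term are the projections of its expansions. -/
theorem exists_expands_of_proj {t : FreeMagma X} {v : FreeMagma Unit} (h : Expands (proj t) v) :
    ∃ t', Expands t t' ∧ proj t' = v := by
  induction h with
  | refl => exact ⟨t, .refl, rfl⟩
  | tail _ h ih =>
    obtain ⟨u, h1, rfl⟩ := ih
    obtain ⟨t', h2, h3⟩ := exists_step_of_proj h
    exact ⟨t', h1.tail h2, h3⟩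

/-- The stopping condition of the algorithm: the projections are equal or comparable. -/
def ProjComparable (t t' : FreeMagma X) : Prop :=
  proj t = proj t' ∨ DividesPlus (proj t) (proj t') ∨ DividesPlus (proj t') (proj t)

theorem ProjComparable.ldEquiv_iff_eq {t t' : FreeMagma X} (h : ProjComparable t t') :
    LDEquiv t t' ↔ t = t' := by
  rcases h with h | h | h
  · exact ldEquiv_iff_eq_of_proj_eq h
  · exact iff_of_false (fun he => not_ldEquiv_of_dividesPlus h he.proj)
      fun he => not_ldEquiv_of_dividesPlus h (he ▸ .refl _)
  · exact iff_of_false (fun he => not_ldEquiv_of_dividesPlus h he.proj.symm)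
      fun he => not_ldEquiv_of_dividesPlus h (he ▸ .refl _)

theorem exists_expands_projComparable (t t' : FreeMagma X) :
    ∃ v v', Expands t v ∧ Expands t' v' ∧ ProjComparable v v' := by
  obtain ⟨s, s', hs, hs', h⟩ := exists_expands_comparable (proj t) (proj t')
  obtain ⟨v, h1, rfl⟩ := exists_expands_of_proj hs
  obtain ⟨v', h2, rfl⟩ := exists_expands_of_proj hs'
  exact ⟨v, v', h1, h2, h⟩

theorem Expands.ldEquiv_congr {t t' v v' : FreeMagma X} (h : Expands t v) (h' : Expands t' v') :
    LDEquiv t t' ↔ LDEquiv v v' :=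
  ⟨fun he => (h.ldEquiv.symm.trans he).trans h'.ldEquiv,
    fun he => (h.ldEquiv.trans he).trans h'.ldEquiv.symm⟩

theorem loopBody_eq_some [DecidableEq X] {t t' : FreeMagma X} {s : List Address × List Address}
    {b : Bool} (h : loopBody t t' s = some b) : b = true ↔ LDEquiv t t' := by
  unfold loopBody at h
  split at h
  · next v v' h1 h2 =>
    rw [(expands_of_expand h1).ldEquiv_congr (expands_of_expand h2)]
    split_ifs at h with h3 h4
    · cases h
      exact iff_of_true rfl (h3 ▸ .refl _)
    · cases h
      rw [ProjComparable.ldEquiv_iff_eq h4]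
      exact iff_of_false Bool.false_ne_true h3
  · cases h

theorem exists_loopBody_eq_some [DecidableEq X] (t t' : FreeMagma X) :
    ∃ s b, loopBody t t' s = some b := by
  obtain ⟨v, v', h1, h2, h⟩ := exists_expands_projComparable t t'
  obtain ⟨s, hs⟩ := h1.exists_expand
  obtain ⟨s', hs'⟩ := h2.exists_expand
  have h' : proj v = proj v' ∨ DividesPlus (proj v) (proj v') ∨ DividesPlus (proj v') (proj v) := h
  refine ⟨(s, s'), decide (v = v'), ?_⟩
  simp only [loopBody, hs, hs', if_pos h']
  split_ifs with h3 <;> simp [h3]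

theorem syntacticAlgorithm_eq_some [DecidableEq X] {e : ℕ → List Address × List Address}
    (he : Function.Surjective e) (t t' : FreeMagma X) :
    ∃ b, syntacticAlgorithm e t t' = Part.some b ∧ (b = true ↔ LDEquiv t t') := by
  obtain ⟨s, a, h⟩ := exists_loopBody_eq_some t t'
  obtain ⟨n, rfl⟩ := he s
  have hd : (syntacticAlgorithm e t t').Dom := Nat.rfindOpt_dom.2 ⟨n, a, h⟩
  obtain ⟨m, hm⟩ := Nat.rfindOpt_spec ⟨hd, rfl⟩
  exact ⟨_, Part.get_eq_iff_eq_some.1 rfl, loopBody_eq_some hm⟩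

end Comparison

section Words

variable {X : Type u}

/-! ### Polish expressions -/

/-- The stack machine that reads a word in right Polish notation, pushing variables and applying
the operation to the two topmost terms; the head of the list is the top of the stack. -/
def run : List (FreeMagma X) → List (Option X) → Option (List (FreeMagma X))
  | st, [] => some st
  | st, some x :: w => run (.of x :: st) w
  | b :: a :: st, none :: w => run (a * b :: st) w
  | [], none :: _ => none
  | [_], none :: _ => none

theorem polish_mul (a b : FreeMagma X) : polish (a * b) = polish a ++ polish b ++ [none] := rfl

theorem run_append (st : List (FreeMagma X)) (u v : List (Option X)) :
    run st (u ++ v) = (run st u).bind fun st' => run st' v := by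
  fun_induction run st u with
  | case1 st => rfl
  | case2 st x w ih => exact ih
  | case3 b a st w ih => exact ih
  | case4 w => rfl
  | case5 a w => rfl

theorem run_polish (st : List (FreeMagma X)) (t : FreeMagma X) :
    run st (polish t) = some (t :: st) := by
  induction t generalizing st with
  | ih1 x => rfl
  | ih2 a b iha ihb => simp [polish_mul, run_append, iha, ihb, run]

theorem run_polish_append (st : List (FreeMagma X)) (t : FreeMagma X) (w : List (Option X)) :
    run st (polish t ++ w) = run (t :: st) w := by
  rw [run_append, run_polish]
  rfl

theorem polish_injective : Function.Injective (polish : FreeMagma X → List (Option X)) := by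
  intro s t h
  have h' := run_polish [] s
  rw [h, run_polish] at h'
  simpa using h'.symm

/-- A word is the concatenation of the Polish expressions of the terms on the final stack. -/
theorem flatMap_polish_of_run {st st' : List (FreeMagma X)} {w : List (Option X)}
    (h : run st w = some st') :
    st.reverse.flatMap polish ++ w = st'.reverse.flatMap polish := by
  fun_induction run st w with
  | case1 st => cases h; simp
  | case2 st x w ih => simpa [polish] using ih h
  | case3 b a st w ih => simpa [polish_mul] using ih h
  | case4 w => cases h
  | case5 a w => cases h

theorem eq_polish_of_run {w : List (Option X)} {t : FreeMagma X} (h : run [] w = some [t]) :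
    w = polish t := by
  simpa using flatMap_polish_of_run h

/-- Replacing the terms on the stack with LD-equivalent ones does not change the final stack, up to
LD-equivalence. -/
theorem run_congr {st st' m : List (FreeMagma X)} {w : List (Option X)}
    (hst : List.Forall₂ LDEquiv st st') (h : run st w = some m) :
    ∃ m', run st' w = some m' ∧ List.Forall₂ LDEquiv m m' := by
  fun_induction run st w generalizing st' with
  | case1 st => cases h; exact ⟨st', rfl, hst⟩
  | case2 st x w ih => exact ih (.cons (.refl _) hst) h
  | case3 b a st w ih =>
    obtain _ | ⟨hb, _ | ⟨ha, hst⟩⟩ := hst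
    exact ih (.cons (ha.mul hb) hst) h
  | case4 w => cases h
  | case5 a w => cases h

/-- Replacing a factor that is the Polish expression of a term with the expression of an
LD-equivalent term. -/
theorem exists_polish_eq_of_factor {t s s' : FreeMagma X} {u v : List (Option X)}
    (h : polish t = u ++ polish s ++ v) (hs : LDEquiv s s') :
    ∃ t', u ++ polish s' ++ v = polish t' ∧ LDEquiv t t' := by
  have h1 := run_polish [] t
  rw [h, List.append_assoc, run_append] at h1
  obtain ⟨st, h2, h3⟩ := Option.bind_eq_some_iff.1 h1
  rw [run_polish_append] at h3
  obtain ⟨m, h4, h5⟩ := run_congr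
    (.cons hs (List.forall₂_same.2 fun a _ => LDEquiv.refl a) : List.Forall₂ LDEquiv _ (s' :: st))
    h3
  obtain _ | ⟨ht, _ | _⟩ := h5
  refine ⟨_, eq_polish_of_run ?_, ht⟩
  rw [List.append_assoc, run_append, h2, Option.bind_some, run_polish_append, h4]

theorem Step.exists_factor {t t' : FreeMagma X} (h : Step t t') :
    ∃ u v a b c, polish t = u ++ polish (a * (b * c)) ++ v ∧
      polish t' = u ++ polish ((a * b) * (a * c)) ++ v := by
  induction h with
  | root a b c => exact ⟨[], [], a, b, c, by simp, by simp⟩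
  | left d _ ih =>
    obtain ⟨u, v, a, b, c, h1, h2⟩ := ih
    exact ⟨u, v ++ polish d ++ [none], a, b, c, by rw [polish_mul, h1]; simp,
      by rw [polish_mul, h2]; simp⟩
  | right d _ ih =>
    obtain ⟨u, v, a, b, c, h1, h2⟩ := ih
    exact ⟨polish d ++ u, v ++ [none], a, b, c, by rw [polish_mul, h1]; simp,
      by rw [polish_mul, h2]; simp⟩

/-- The bottom of the stack only grows, as an iterated left subterm. -/
theorem exists_dividesStar_of_run {st m : List (FreeMagma X)} {s : FreeMagma X}
    {w : List (Option X)} (h : run (st ++ [s]) w = some m) :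
    ∃ m' s', m = m' ++ [s'] ∧ DividesStar s s' := by
  induction w generalizing st s with
  | nil => cases h; exact ⟨st, s, rfl, .refl s⟩
  | cons o w ih =>
    cases o with
    | some x => exact ih (st := .of x :: st) h
    | none =>
      match st, h with
      | [], h => cases h
      | [b], h =>
        obtain ⟨m', s', h1, h2⟩ := ih (st := []) (s := s * b) h
        refine ⟨m', s', h1, ?_⟩
        have h3 : DividesPlus s (s * b) := .single ⟨b, rfl⟩
        rcases h2 with rfl | h2
        · exact .inr h3
        · exact .inr (h3.trans h2)
      | b :: a :: st, h => exact ih (st := a * b :: st) h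

theorem dividesStar_iff_exists_append {s t : FreeMagma X} :
    DividesStar s t ↔ ∃ v, polish s ++ v = polish t := by
  constructor
  · intro h
    induction t with
    | ih1 x =>
      rcases h with rfl | h
      · exact ⟨[], List.append_nil _⟩
      · exact absurd h (not_dividesPlus_of _ _)
    | ih2 a b iha _ =>
      rcases dividesStar_mul_iff.1 h with rfl | h
      · exact ⟨[], List.append_nil _⟩
      · obtain ⟨v, hv⟩ := iha h
        exact ⟨v ++ polish b ++ [none], by rw [polish_mul, ← hv]; simp⟩
  · rintro ⟨v, hv⟩
    have h := run_polish [] t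
    rw [← hv, run_polish_append] at h
    obtain ⟨m', s', h1, h2⟩ := exists_dividesStar_of_run (st := []) h
    obtain ⟨-, h3⟩ := List.append_inj' (s₁ := []) h1 rfl
    cases h3
    exact h2

/-- The effect on the depth of the stack of reading a letter. A stack of `n` terms is encoded as
`n + 1`, and `0` means that the machine has failed. -/
def depthStep (d : ℕ) (o : Option X) : ℕ :=
  if d = 0 ∨ (o = none ∧ d < 3) then 0 else if o = none then d - 1 else d + 1

theorem foldl_depthStep_zero (w : List (Option X)) : w.foldl depthStep 0 = 0 := by
  induction w with
  | nil => rfl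
  | cons o w ih => simpa [depthStep] using ih

theorem foldl_depthStep (st : List (FreeMagma X)) (w : List (Option X)) :
    w.foldl depthStep (st.length + 1) = (run st w).elim 0 fun m => m.length + 1 := by
  fun_induction run st w with
  | case1 st => rfl
  | case2 st x w ih => simpa [depthStep] using ih
  | case3 b a st w ih =>
    simpa [depthStep, show ¬ st.length + 1 + 1 + 1 < 3 by omega] using ih
  | case4 w => simpa [depthStep] using foldl_depthStep_zero w
  | case5 a w => simpa [depthStep] using foldl_depthStep_zero w

/-- The word is a Polish expression, tested by counting the terms on the stack. -/
def IsPolish (w : List (Option X)) : Prop := w.foldl depthStep 1 = 2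

instance : DecidablePred (IsPolish (X := X)) := fun _ => inferInstanceAs (Decidable (_ = _))

theorem isPolish_iff {w : List (Option X)} : IsPolish w ↔ ∃ t, w = polish t := by
  have h := foldl_depthStep ([] : List (FreeMagma X)) w
  rw [List.length_nil, zero_add] at h
  constructor
  · intro hw
    rw [IsPolish, h] at hw
    match hr : run [] w with
    | none => simp [hr] at hw
    | some [] => simp [hr] at hw
    | some [t] => exact ⟨t, eq_polish_of_run hr⟩
    | some (_ :: _ :: _) => simp [hr] at hw
  · rintro ⟨t, rfl⟩
    rw [IsPolish, h, run_polish]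
    rfl

theorem isPolish_polish (t : FreeMagma X) : IsPolish (polish t) := isPolish_iff.2 ⟨t, rfl⟩

/-! ### Expansions of words -/

/-- Five words `u, a, b, c, v`, which describe an occurrence of `a * (b * c)` in a word. -/
abbrev Redex (X : Type u) : Type u :=
  List (Option X) × List (Option X) × List (Option X) × List (Option X) × List (Option X)

/-- The redex occurs in the word, and its three middle parts are Polish expressions. -/
def Redex.OccursIn (k : Redex X) (w : List (Option X)) : Prop :=
  (IsPolish k.2.1 ∧ IsPolish k.2.2.1 ∧ IsPolish k.2.2.2.1) ∧
    w = k.1 ++ (k.2.1 ++ (k.2.2.1 ++ (k.2.2.2.1 ++ (none :: none :: k.2.2.2.2))))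

/-- The word in which the redex has been expanded to `(a * b) * (a * c)`. -/
def Redex.expanded (k : Redex X) : List (Option X) :=
  k.1 ++ (k.2.1 ++ (k.2.2.1 ++ (none :: (k.2.1 ++ (k.2.2.2.1 ++
    (none :: none :: k.2.2.2.2))))))

section Decidable

variable [DecidableEq X]

instance (k : Redex X) (w : List (Option X)) : Decidable (k.OccursIn w) :=
  inferInstanceAs (Decidable (_ ∧ _))

/-- Expand a word at a redex; the word is kept if the redex does not occur in it. -/
def expandRedex (w : List (Option X)) (k : Redex X) : List (Option X) :=
  if k.OccursIn w then k.expanded else w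

/-- Expand a word at the redexes of a list, one after the other. -/
def expandWord (w : List (Option X)) (l : List (Redex X)) : List (Option X) :=
  l.foldl expandRedex w

theorem exists_expandRedex_polish (t : FreeMagma X) (k : Redex X) :
    ∃ t', expandRedex (polish t) k = polish t' ∧ LDEquiv t t' := by
  unfold expandRedex
  split_ifs with h
  · obtain ⟨u, a, b, c, v⟩ := k
    obtain ⟨⟨ha, hb, hc⟩, h⟩ := h
    obtain ⟨a, rfl⟩ := isPolish_iff.1 ha
    obtain ⟨b, rfl⟩ := isPolish_iff.1 hb
    obtain ⟨c, rfl⟩ := isPolish_iff.1 hc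
    obtain ⟨t', h1, h2⟩ := exists_polish_eq_of_factor (u := u) (v := v)
      (h.trans (by simp [polish_mul])) (.distrib a b c)
    exact ⟨t', .trans (by simp [polish_mul, Redex.expanded]) h1, h2⟩
  · exact ⟨t, rfl, .refl t⟩

theorem exists_expandWord_polish (t : FreeMagma X) (l : List (Redex X)) :
    ∃ t', expandWord (polish t) l = polish t' ∧ LDEquiv t t' := by
  induction l generalizing t with
  | nil => exact ⟨t, rfl, .refl t⟩
  | cons k l ih =>
    obtain ⟨s, h1, h2⟩ := exists_expandRedex_polish t k
    obtain ⟨t', h3, h4⟩ := ih s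
    exact ⟨t', by rw [← h3, ← h1]; rfl, h2.trans h4⟩

theorem Step.exists_expandRedex {t t' : FreeMagma X} (h : Step t t') :
    ∃ k, expandRedex (polish t) k = polish t' := by
  obtain ⟨u, v, a, b, c, h1, h2⟩ := h.exists_factor
  refine ⟨(u, polish a, polish b, polish c, v), ?_⟩
  rw [expandRedex, if_pos, h2]
  · simp [polish_mul, Redex.expanded]
  · exact ⟨⟨isPolish_polish a, isPolish_polish b, isPolish_polish c⟩,
      h1.trans (by simp [polish_mul])⟩

theorem Expands.exists_expandWord {t t' : FreeMagma X} (h : Expands t t') :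
    ∃ l, expandWord (polish t) l = polish t' := by
  induction h using Relation.ReflTransGen.head_induction_on with
  | refl => exact ⟨[], rfl⟩
  | head h _ ih =>
    obtain ⟨k, hk⟩ := h.exists_expandRedex
    obtain ⟨l, hl⟩ := ih
    exact ⟨k :: l, by rw [← hl, ← hk]; rfl⟩

end Decidable

/-! ### Decidability of the word problem -/

/-- The word with all variables identified. -/
def shape (w : List (Option X)) : List (Option Unit) := w.map (Option.map fun _ => ())

theorem shape_polish (t : FreeMagma X) : shape (polish t) = polish (proj t) := by
  induction t with
  | ih1 x => rfl
  | ih2 a b iha ihb =>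
    rw [proj_mul, polish_mul, polish_mul, ← iha, ← ihb]
    simp [shape]

/-- One of the two shapes extends the other by the word `v`. -/
def ShapesExtend (w w' : List (Option X)) (v : List (Option Unit)) : Prop :=
  shape w ++ v = shape w' ∨ shape w' ++ v = shape w

instance (w w' : List (Option X)) (v : List (Option Unit)) : Decidable (ShapesExtend w w' v) :=
  inferInstanceAs (Decidable (_ ∨ _))

theorem projComparable_iff_exists_shapesExtend {t t' : FreeMagma X} :
    ProjComparable t t' ↔ ∃ v, ShapesExtend (polish t) (polish t') v := by
  simp only [ShapesExtend, shape_polish, exists_or, ← dividesStar_iff_exists_append, DividesStar,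
    ProjComparable]
  grind

/-- What the search for an answer tries: redexes at which to expand the two words, and a word
that shows that the resulting shapes are comparable. -/
abbrev Certificate (X : Type u) : Type u :=
  (List (Redex X) × List (Redex X)) × List (Option Unit)

variable [DecidableEq X]

/-- The answer for a pair of words that a certificate gives, if any. The answer is `false` for
words that are not Polish expressions, so that a search for a certificate always ends. -/
def answer (p : List (Option X) × List (Option X)) (c : Certificate X) : Option Bool :=
  if IsPolish p.1 ∧ IsPolish p.2 then
    if ShapesExtend (expandWord p.1 c.1.1) (expandWord p.2 c.1.2) c.2 then
      some (decide (expandWord p.1 c.1.1 = expandWord p.2 c.1.2))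
    else none
  else some false

theorem answer_polish {t t' : FreeMagma X} {c : Certificate X} {b : Bool}
    (h : answer (polish t, polish t') c = some b) : b = true ↔ LDEquiv t t' := by
  obtain ⟨v, h1, h2⟩ := exists_expandWord_polish t c.1.1
  obtain ⟨v', h1', h2'⟩ := exists_expandWord_polish t' c.1.2
  rw [answer, if_pos ⟨isPolish_polish t, isPolish_polish t'⟩, h1, h1'] at h
  split_ifs at h with h3
  cases h
  rw [decide_eq_true_iff, polish_injective.eq_iff,
    ← (projComparable_iff_exists_shapesExtend.2 ⟨_, h3⟩).ldEquiv_iff_eq]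
  exact ⟨fun h => (h2.trans h).trans h2'.symm, fun h => (h2.symm.trans h).trans h2'⟩

theorem exists_answer (p : List (Option X) × List (Option X)) : ∃ c b, answer p c = some b := by
  by_cases hp : IsPolish p.1 ∧ IsPolish p.2
  · obtain ⟨w, w'⟩ := p
    obtain ⟨⟨t, rfl⟩, t', rfl⟩ := hp.imp isPolish_iff.1 isPolish_iff.1
    obtain ⟨v, v', h1, h2, h⟩ := exists_expands_projComparable t t'
    obtain ⟨l, hl⟩ := h1.exists_expandWord
    obtain ⟨l', hl'⟩ := h2.exists_expandWord
    obtain ⟨z, hz⟩ := projComparable_iff_exists_shapesExtend.1 h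
    refine ⟨((l, l'), z), decide (polish v = polish v'), ?_⟩
    rw [answer, if_pos hp, hl, hl', if_pos hz]
  · exact ⟨(([], []), []), false, if_neg hp⟩

end Words

section Computability

open Primrec

variable {X : Type u} [Primcodable X]

theorem primrecPred_isPolish : PrimrecPred (IsPolish (X := X)) := by
  have hn : PrimrecPred fun q : List (Option X) × ℕ × Option X => q.2.2 = none :=
    Primrec.eq.comp (snd.comp snd) (const none)
  have hd : Primrec fun q : List (Option X) × ℕ × Option X => q.2.1 := fst.comp snd
  have hs : Primrec₂ fun (_ : List (Option X)) (q : ℕ × Option X) => depthStep q.1 q.2 :=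
    Primrec.ite
      ((Primrec.eq.comp hd (const 0)).or (hn.and (Primrec.nat_lt.comp hd (const 3))))
      (const 0) (Primrec.ite hn (Primrec.pred.comp hd) (Primrec.succ.comp hd))
  exact Primrec.eq.comp (Primrec.list_foldl Primrec.id (const 1) hs) (const 2)

theorem primrec_shape : Primrec (shape (X := X)) :=
  Primrec.list_map Primrec.id (Primrec.option_map snd (const ()).to₂).to₂

variable [DecidableEq X]

theorem primrec_expandRedex : Primrec₂ (expandRedex (X := X)) := by
  have hu : Primrec fun q : List (Option X) × Redex X => q.2.1 := fst.comp snd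
  have ha : Primrec fun q : List (Option X) × Redex X => q.2.2.1 := fst.comp (snd.comp snd)
  have hb : Primrec fun q : List (Option X) × Redex X => q.2.2.2.1 :=
    fst.comp (snd.comp (snd.comp snd))
  have hc : Primrec fun q : List (Option X) × Redex X => q.2.2.2.2.1 :=
    fst.comp (snd.comp (snd.comp (snd.comp snd)))
  have hv : Primrec fun q : List (Option X) × Redex X => q.2.2.2.2.2 :=
    snd.comp (snd.comp (snd.comp (snd.comp snd)))
  have app {f g : List (Option X) × Redex X → List (Option X)} (hf : Primrec f)
      (hg : Primrec g) : Primrec fun q => f q ++ g q := Primrec.list_append.comp hf hg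
  have op {f : List (Option X) × Redex X → List (Option X)} (hf : Primrec f) :
      Primrec fun q => none :: f q := Primrec.list_cons.comp (const none) hf
  exact Primrec.ite
    (((primrecPred_isPolish.comp ha).and
      ((primrecPred_isPolish.comp hb).and (primrecPred_isPolish.comp hc))).and
      (Primrec.eq.comp fst (app hu (app ha (app hb (app hc (op (op hv))))))))
    (app hu (app ha (app hb (op (app ha (app hc (op (op hv)))))))) fst

theorem primrec_expandWord : Primrec₂ (expandWord (X := X)) :=
  Primrec.list_foldl snd fst (primrec_expandRedex.comp (fst.comp snd) (snd.comp snd)).to₂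

theorem primrec_answer : Primrec₂ (answer (X := X)) := by
  have hw : Primrec fun q : (List (Option X) × List (Option X)) × Certificate X =>
      expandWord q.1.1 q.2.1.1 :=
    primrec_expandWord.comp (fst.comp fst) (fst.comp (fst.comp snd))
  have hw' : Primrec fun q : (List (Option X) × List (Option X)) × Certificate X =>
      expandWord q.1.2 q.2.1.2 :=
    primrec_expandWord.comp (snd.comp fst) (snd.comp (fst.comp snd))
  have hs := primrec_shape.comp hw
  have hs' := primrec_shape.comp hw'
  have hv : Primrec fun q : (List (Option X) × List (Option X)) × Certificate X => q.2.2 :=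
    snd.comp snd
  exact Primrec.ite
    ((primrecPred_isPolish.comp (fst.comp fst)).and (primrecPred_isPolish.comp (snd.comp fst)))
    (Primrec.ite
      ((Primrec.eq.comp (Primrec.list_append.comp hs hv) hs').or
        (Primrec.eq.comp (Primrec.list_append.comp hs' hv) hs))
      (Primrec.option_some.comp (Primrec.eq.comp hw hw').decide) (const none))
    (const (some false))

/-- The word problem is decided by a search through all certificates. -/
theorem exists_computable_ldEquiv : ∃ f : List (Option X) × List (Option X) → Bool,
    Computable f ∧ ∀ T T' : FreeMagma X, f (polish T, polish T') = true ↔ LDEquiv T T' := by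
  let search (p : List (Option X) × List (Option X)) (n : ℕ) : Option Bool :=
    (Encodable.decode n : Option (Certificate X)).bind (answer p)
  have hc : Computable₂ search :=
    (Primrec.option_bind (Primrec.decode.comp snd)
      (primrec_answer.comp (fst.comp fst) snd).to₂).to_comp
  have hd (p) : (Nat.rfindOpt (search p)).Dom := by
    obtain ⟨c, b, h⟩ := exists_answer p
    exact Nat.rfindOpt_dom.2
      ⟨Encodable.encode c, b, Option.bind_eq_some_iff.2 ⟨c, Encodable.encodek c, h⟩⟩
  refine ⟨fun p => (Nat.rfindOpt (search p)).get (hd p),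
    (Partrec.rfindOpt hc).of_eq_tot fun p => Part.get_mem _, fun T T' => ?_⟩
  obtain ⟨n, hn⟩ := Nat.rfindOpt_spec (Part.get_mem (hd (polish T, polish T')))
  obtain ⟨c, -, h⟩ := Option.bind_eq_some_iff.1 hn
  exact answer_polish h

end Computability

end SelfDist

theorem lemmaL {X : Type*} :
    -- Terms with cuts that coincide except in their rightmost variables are not LD-equivalent.
    (∀ (T T' : FreeMagma X) (α α' : SelfDist.Address) (c c' : FreeMagma X),
      SelfDist.cut T α = some c → SelfDist.cut T' α' = some c' →
      SelfDist.CoincideExceptRightmost c c' → ¬ SelfDist.LDEquiv T T') ∧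
    -- Terms with the same one-variable projection are LD-equivalent only if they are equal.
    (∀ T T' : FreeMagma X, SelfDist.proj T = SelfDist.proj T' →
      (SelfDist.LDEquiv T T' ↔ T = T')) ∧
    -- The syntactic algorithm always terminates, and its answer is correct.
    (∀ [DecidableEq X] (e : ℕ → List SelfDist.Address × List SelfDist.Address),
      Function.Surjective e → ∀ T T' : FreeMagma X,
        (SelfDist.LDEquiv T T' → SelfDist.syntacticAlgorithm e T T' = Part.some true) ∧
        (¬ SelfDist.LDEquiv T T' → SelfDist.syntacticAlgorithm e T T' = Part.some false)) ∧
    -- The word problem is decidable.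
    (∀ [Primcodable X], ∃ f : List (Option X) × List (Option X) → Bool, Computable f ∧
      ∀ T T' : FreeMagma X,
        f (SelfDist.polish T, SelfDist.polish T') = true ↔ SelfDist.LDEquiv T T') := by
  refine ⟨fun T T' α α' c c' => SelfDist.not_ldEquiv_of_cut,
    fun T T' => SelfDist.ldEquiv_iff_eq_of_proj_eq, ?_, ?_⟩
  · intro _ e he T T'
    obtain ⟨b, h1, h2⟩ := SelfDist.syntacticAlgorithm_eq_some he T T'
    rw [h1, ← h2]
    cases b <;> simp
  · intro _
    classical
    exact SelfDist.exists_computable_ldEquiv
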